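/- Let $G$ be a second countable, $\sigma$-compact, locally compact Hausdorff abelian group. **Point sets.** A set $S\subseteq G$ is *uniformly discrete* if there is a neighbourhood $U$ of $0$ such that $x,y\in S$, $x-y\in U$ imply $x=y$, and *relatively dense* if $S+K=G$ for some compact $K$ (the same definitions are used in every locally compact Hausdorff abelian group). A *Meyer set* is a uniformly discrete and relatively dense set $\Lambda\subseteq G$ such that $\Lambda-\Lambda\subseteq\Lambda+F$ for some finite set $F\subseteq G$. It is *repetitive* if for every compact $K\subseteq G$ the set $\{t\in G:(\Lambda-t)\cap K=\Lambda\cap K\}$ is relatively dense. **Hull.** The hull of $\Lambda$ is $$X_\Lambda=\{\Lambda'\subseteq G:\ \forall K\subseteq G\text{ compact }\exists t\in G,\ \Lambda'\cap K=(\Lambda-t)\cap K\},$$ with the topology of the uniformity having as basis the sets $\{(\Lambda_1,\Lambda_2)\in X_\Lambda\times X_\Lambda:\exists t,t'\in U,\ (\Lambda_1-t)\cap K=(\Lambda_2-t')\cap K\}$, where $K\subseteq G$ is compact and $U$ is a neighbourhood of $0$ in $G$, and with the $G$-action $t.\Lambda'=\Lambda'-t$. **Model sets.** A *non-singular model set*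 in $G$ is a set of the form $\{t\in G:\exists (t',t)\in\Gamma,\ t'\in W\}$, where $H$ is a locally compact Hausdorff abelian group, $\Gamma\subset H\times G$ is a lattice (a uniformly discrete and relatively dense subgroup), $W\subseteq H$ is a compact set equal to the closure of its interior, and no point of $\Gamma$ has its projection to $H$ in the boundary of $W$. A *repetitive model set* is an element of the hull $X_{\Lambda_0}$ of some repetitive Meyer set $\Lambda_0$ such that $X_{\Lambda_0}$ contains a non-singular model set. **Almost automorphy.** A factor map between $G$-systems is a continuous surjective $G$-equivariant map. The maximal equicontinuous factor of a $G$-system $X$ is the (unique up to conjugacy) equicontinuous compact Hausdorff factor $\pi:X\to X_{eq}$ through which every other equicontinuous compact Hausdorff factor of $X$ factorizes. The system is *almost automorphic* if $\pi^{-1}(z)$ is a single point for some $z\in X_{eq}$, and $x\in X$ is an *almost automorphic point* if $\pi^{-1}(\pi(x))=\{x\}$. **Theorem.** Let $\Lambda\subseteq G$. 1. $\Lambda$ is a repetitive model set if and only if $\Lambda$ is a repetitive Meyer set and the dynamical system $(X_\Lambda,G)$ is almost automorphic. 2. If $\Lambda$ is a Meyer set, then $\Lambda$ is a non-singular model set if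 and only if $(X_\Lambda,G)$ is almost automorphic with $\Lambda\in X_\Lambda$ an almost automorphic point. -/

import Mathlib

open Set Filter Topology

universe u v w

namespace MeyerSets

section PointSets

variable {G : Type u} [AddCommGroup G]

/-- The translated set `Λ - t`. -/
def translateSet (Λ : Set G) (t : G) : Set G := {x | x + t ∈ Λ}

theorem translate_zero (Λ : Set G) : translateSet Λ 0 = Λ := by
  simp [translateSet]

theorem translate_translate (Λ : Set G) (s t : G) :
    translateSet (translateSet Λ s) t = translateSet Λ (s + t) := by
  ext x
  simp only [translateSet, mem_ofPred_eq]
  rw [add_assoc, add_comm t s]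

theorem translate_inter_eq {A B K : Set G} {s : G}
    (h : A ∩ ((fun x => x + s) '' K) = B ∩ ((fun x => x + s) '' K)) :
    translateSet A s ∩ K = translateSet B s ∩ K := by
  ext x
  have hx := Set.ext_iff.1 h (x + s)
  simp only [translateSet, mem_inter_iff, mem_ofPred_eq, mem_image, add_left_inj, exists_eq_right]
    at hx ⊢
  exact hx

variable [TopologicalSpace G]

/-- Distinct points of `S` never differ by an element of a fixed neighbourhood of `0`. -/
def IsUniformlyDiscrete (S : Set G) : Prop :=
  ∃ U ∈ 𝓝 (0 : G), ∀ x ∈ S, ∀ y ∈ S, x - y ∈ U → x = y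

/-- `S + K` is the whole group for some compact set `K`. -/
def IsRelativelyDense (S : Set G) : Prop :=
  ∃ K : Set G, IsCompact K ∧ ∀ x : G, ∃ s ∈ S, ∃ k ∈ K, x = s + k

/-- Meyer sets: uniformly discrete, relatively dense, and `Λ - Λ ⊆ Λ + F` with `F` finite. -/
structure IsMeyer (Λ : Set G) : Prop where
  uniformlyDiscrete : IsUniformlyDiscrete Λ
  relativelyDense : IsRelativelyDense Λ
  diff_subset : ∃ F : Set G, F.Finite ∧
    ∀ x ∈ Λ, ∀ y ∈ Λ, ∃ z ∈ Λ, ∃ f ∈ F, x - y = z + f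

/-- The return times `{t | (Λ - t) ∩ K = Λ ∩ K}`. -/
def returnTimes (Λ K : Set G) : Set G := {t | translateSet Λ t ∩ K = Λ ∩ K}

/-- All sets of return times to compact patches are relatively dense. -/
def IsRepetitive (Λ : Set G) : Prop :=
  ∀ K : Set G, IsCompact K → IsRelativelyDense (returnTimes Λ K)

/-- A lattice: a uniformly discrete and relatively dense subgroup. -/
def IsLattice (Γ : AddSubgroup G) : Prop :=
  IsUniformlyDiscrete (Γ : Set G) ∧ IsRelativelyDense (Γ : Set G)

end PointSets

section ModelSets

variable {G : Type u} [AddCommGroup G]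

/-- The cut and project set `{t | ∃ (t', t) ∈ Γ, t' ∈ W}`. -/
def cutAndProject {H : Type w} [AddCommGroup H] (Γ : AddSubgroup (H × G)) (W : Set H) : Set G :=
  {t | ∃ t' : H, (t', t) ∈ Γ ∧ t' ∈ W}

/-- Non-singular model sets: cut and project sets obtained from a locally compact Hausdorff
abelian group `H`, a lattice `Γ` in `H × G`, and a compact window `W` in `H` which is the closure
of its interior and whose boundary contains the projection of no point of `Γ`. -/
def IsNonsingularModelSet [TopologicalSpace G] (Λ : Set G) : Prop :=
  ∃ (H : Type u) (_ : AddCommGroup H) (_ : TopologicalSpace H) (_ : IsTopologicalAddGroup H)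
    (_ : LocallyCompactSpace H) (_ : T2Space H) (Γ : AddSubgroup (H × G)) (W : Set H),
    IsLattice Γ ∧ IsCompact W ∧ W = closure (interior W) ∧
      (∀ γ ∈ Γ, γ.1 ∉ frontier W) ∧ Λ = cutAndProject Γ W

end ModelSets

section Hull

variable {G : Type u} [AddCommGroup G] [TopologicalSpace G]

/-- Membership in the hull of `Λ`: every patch of `Λ'` on a compact set is the patch of
some translate of `Λ`. -/
def InHull (Λ Λ' : Set G) : Prop :=
  ∀ K : Set G, IsCompact K → ∃ t : G, Λ' ∩ K = translateSet Λ t ∩ K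

/-- The hull `X_Λ` of a point set. -/
@[ext]
structure Hull (Λ : Set G) where
  carrier : Set G
  inHull : InHull Λ carrier

/-- `Λ` as a point of its hull. -/
def Hull.base (Λ : Set G) : Hull Λ :=
  ⟨Λ, fun _ _ => ⟨0, by rw [translate_zero]⟩⟩

theorem InHull.translateSet [IsTopologicalAddGroup G] {Λ Λ' : Set G} (h : InHull Λ Λ') (s : G) :
    InHull Λ (translateSet Λ' s) := by
  intro K hK
  obtain ⟨t, ht⟩ := h ((fun x => x + s) '' K) (hK.image (continuous_id.add continuous_const))
  exact ⟨t + s, by rw [← translate_translate]; exact translate_inter_eq ht⟩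

/-- The action `t.Λ' = Λ' - t` on the hull. -/
instance instAddActionHull [IsTopologicalAddGroup G] (Λ : Set G) : AddAction G (Hull Λ) where
  vadd t A := ⟨translateSet A.carrier t, A.inHull.translateSet t⟩
  zero_vadd A := Hull.ext (translate_zero A.carrier)
  add_vadd s t A := Hull.ext (by
    change translateSet A.carrier (s + t) =
      translateSet (translateSet A.carrier t) s
    rw [translate_translate, add_comm])

/-- The basic entourage attached to `K` and `U`: pairs `(A, B)` such that
`(A - t) ∩ K = (B - t') ∩ K` for some `t, t' ∈ U`. -/
def hullEntourage (Λ K U : Set G) : Set (Hull Λ × Hull Λ) :=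
  {p | ∃ t ∈ U, ∃ t' ∈ U, translateSet p.1.carrier t ∩ K = translateSet p.2.carrier t' ∩ K}

theorem hullEntourage_mono (Λ : Set G) {K K' U U' : Set G} (hK : K' ⊆ K) (hU : U ⊆ U') :
    hullEntourage Λ K U ⊆ hullEntourage Λ K' U' := by
  rintro p ⟨t, ht, t', ht', h⟩
  refine ⟨t, hU ht, t', hU ht', ?_⟩
  rw [← inter_eq_right.2 hK, ← inter_assoc, ← inter_assoc, h]

/-- The filter on `X_Λ × X_Λ` with basis the entourages attached to a compact set `K` and a
neighbourhood `U` of `0`. -/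
def hullUniformity (Λ : Set G) : Filter (Hull Λ × Hull Λ) where
  sets := {S | ∃ K U : Set G, IsCompact K ∧ U ∈ 𝓝 (0 : G) ∧ hullEntourage Λ K U ⊆ S}
  univ_sets := ⟨∅, univ, isCompact_empty, univ_mem, subset_univ _⟩
  sets_of_superset := by
    rintro S T ⟨K, U, hK, hU, h⟩ hST
    exact ⟨K, U, hK, hU, h.trans hST⟩
  inter_sets := by
    rintro S T ⟨K, U, hK, hU, h⟩ ⟨K', U', hK', hU', h'⟩
    exact ⟨K ∪ K', U ∩ U', hK.union hK', inter_mem hU hU', subset_inter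
      ((hullEntourage_mono Λ subset_union_left inter_subset_left).trans h)
      ((hullEntourage_mono Λ subset_union_right inter_subset_right).trans h')⟩

theorem mem_hullUniformity {Λ : Set G} {S : Set (Hull Λ × Hull Λ)} :
    S ∈ hullUniformity Λ ↔
      ∃ K U : Set G, IsCompact K ∧ U ∈ 𝓝 (0 : G) ∧ hullEntourage Λ K U ⊆ S :=
  Iff.rfl

theorem hullUniformity_comp [IsTopologicalAddGroup G] [LocallyCompactSpace G] (Λ : Set G) :
    ((hullUniformity Λ).lift' fun S => SetRel.comp S S) ≤ hullUniformity Λ := by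
  rintro S ⟨K, U, hK, hU, hS⟩
  obtain ⟨V, hV, hVU⟩ := exists_nhds_zero_half hU
  obtain ⟨C, hC, hC0⟩ := exists_compact_mem_nhds (0 : G)
  have hKC : IsCompact ((fun p : G × G => p.1 + p.2) '' (K ×ˢ C)) :=
    (hK.prod hC).image continuous_add
  have hsub : ∀ s ∈ C, (fun x => x + s) '' K ⊆ (fun p : G × G => p.1 + p.2) '' (K ×ˢ C) := by
    rintro s hs _ ⟨x, hx, rfl⟩
    exact ⟨(x, s), ⟨hx, hs⟩, rfl⟩
  refine mem_of_superset (mem_lift' (mem_hullUniformity.2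
    ⟨_, V ∩ C, hKC, inter_mem hV hC0, Subset.rfl⟩)) ?_
  refine Subset.trans ?_ hS
  rintro ⟨A, B⟩ ⟨D, ⟨t, ht, t', ht', h⟩, ⟨s, hs, s', hs', h'⟩⟩
  have restrict : ∀ {P Q L M : Set G}, L ⊆ M → P ∩ M = Q ∩ M → P ∩ L = Q ∩ L := by
    intro P Q L M hLM hPQ
    rw [← inter_eq_right.2 hLM, ← inter_assoc, ← inter_assoc, hPQ]
  have e1 := translate_inter_eq (restrict (hsub s hs.2) h)
  have e2 := translate_inter_eq (restrict (hsub t' ht'.2) h')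
  rw [translate_translate, translate_translate] at e1 e2
  refine ⟨t + s, hVU t ht.1 s hs.1, s' + t', hVU s' hs'.1 t' ht'.1, ?_⟩
  exact e1.trans ((by rw [add_comm t' s]) : _ = _) |>.trans e2

/-- The uniform structure, hence the topology, of the hull. -/
instance instUniformSpaceHull [IsTopologicalAddGroup G] [LocallyCompactSpace G] (Λ : Set G) :
    UniformSpace (Hull Λ) :=
  UniformSpace.ofCore
    { uniformity := hullUniformity Λ
      refl := by
        rintro S ⟨K, U, _, hU, hS⟩
        rintro ⟨A, B⟩ hAB
        obtain rfl : A = B := hAB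
        exact hS ⟨0, mem_of_mem_nhds hU, 0, mem_of_mem_nhds hU, rfl⟩
      symm := by
        rintro S ⟨K, U, hK, hU, hS⟩
        refine ⟨K, U, hK, hU, ?_⟩
        rintro p ⟨t, ht, t', ht', h⟩
        exact hS ⟨t', ht', t, ht, h.symm⟩
      comp := hullUniformity_comp Λ }

/-- Repetitive model sets: the elements of the hull `X_Λ₀` of a repetitive Meyer set `Λ₀` such that
this hull contains a non-singular model set. -/
def IsRepetitiveModelSet (Λ : Set G) : Prop :=
  ∃ Λ₀ : Set G, IsMeyer Λ₀ ∧ IsRepetitive Λ₀ ∧ InHull Λ₀ Λ ∧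
    ∃ Λ' : Set G, InHull Λ₀ Λ' ∧ IsNonsingularModelSet Λ'

end Hull

section Dynamics

variable (G : Type u) [AddCommGroup G] [TopologicalSpace G]

/-- Factor maps: continuous equivariant surjections. -/
structure IsFactorMap {X : Type v} {Y : Type w} [TopologicalSpace X] [TopologicalSpace Y]
    [AddAction G X] [AddAction G Y] (π : X → Y) : Prop where
  continuous : Continuous π
  surjective : Function.Surjective π
  map_vadd : ∀ (t : G) (x : X), π (t +ᵥ x) = t +ᵥ π x

/-- The translations `y ↦ t +ᵥ y`, for `t` in `G`, form an equicontinuous family. -/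
def IsEquicontinuousAction (Y : Type v) [UniformSpace Y] [AddAction G Y] : Prop :=
  UniformEquicontinuous (fun (t : G) (y : Y) => t +ᵥ y)

/-- `π` is the factor map of `X` onto its maximal equicontinuous factor `Y`: an equicontinuous
factor through which every other equicontinuous factor of `X` factorizes. -/
structure IsMaxEquicontinuousFactor {X Y : Type v} [TopologicalSpace X] [AddAction G X]
    [UniformSpace Y] [AddAction G Y] (π : X → Y) : Prop where
  isFactorMap : IsFactorMap G π
  equicontinuous : IsEquicontinuousAction G Y
  maximal : ∀ (Z : Type v) [UniformSpace Z] [CompactSpace Z] [T2Space Z] [AddAction G Z]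
    [ContinuousVAdd G Z] (ρ : X → Z), IsFactorMap G ρ → IsEquicontinuousAction G Z →
      ∃ φ : Y → Z, IsFactorMap G φ ∧ ρ = φ ∘ π

/-- The factor map onto the maximal equicontinuous factor (which is unique up to conjugacy) is
one-to-one over some point. -/
def IsAlmostAutomorphic (X : Type v) [TopologicalSpace X] [AddAction G X] : Prop :=
  ∃ (Y : Type v) (_ : UniformSpace Y) (_ : CompactSpace Y) (_ : T2Space Y) (_ : AddAction G Y)
    (_ : ContinuousVAdd G Y) (π : X → Y),
    IsMaxEquicontinuousFactor G π ∧ ∃ y : Y, ∃! x : X, π x = y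

/-- The fibre of `x` under the factor map onto the maximal equicontinuous factor is `{x}`. -/
def IsAlmostAutomorphicPoint {X : Type v} [TopologicalSpace X] [AddAction G X] (x : X) : Prop :=
  ∃ (Y : Type v) (_ : UniformSpace Y) (_ : CompactSpace Y) (_ : T2Space Y) (_ : AddAction G Y)
    (_ : ContinuousVAdd G Y) (π : X → Y),
    IsMaxEquicontinuousFactor G π ∧ ∀ x' : X, π x' = π x → x' = x

end Dynamics

end MeyerSets

/-! Everything passes through one combinatorial property of a Meyer set `A`, `IsPatchRigid`: if `A -
s` and `A - t` agree on a large enough compact set, then `t - s` is a return time of `A` to a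
prescribed compact set. This amounts to being a non-singular model set, and, when the orbit of `A`
is dense in the hull, to being an almost automorphic point.

A non-singular model set is rigid because membership in it is clopen for the topology pulled back
from the internal space (`IsNonsingularModelSet.isPatchRigid`). Conversely, rigidity says that the
sets of return times generate a group topology on `G`; its completion is an internal space, with
window the closure of the image of `A` (`IsPatchRigid.isNonsingularModelSet`).

On the dynamical side, a one-point fibre over an equicontinuous factor forces rigidity
(`isPatchRigid_of_fiber_eq_singleton`). Conversely, completing `G` for the coarser topology
generated by return times plus neighbourhoods of `0` yields the maximal equicontinuous factor
(`IsPatchRigid.isAlmostAutomorphicPoint`). Repetitivity enters only to make the hull minimal, so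
that orbits are dense. -/

set_option linter.unusedSectionVars false

namespace MeyerSets

open scoped Pointwise

/-! ### Patches, local finiteness, and inheritance by elements of the hull. -/

section Patches

variable {G : Type u} [AddCommGroup G]

theorem mem_translateSet {A : Set G} {t x : G} : x ∈ translateSet A t ↔ x + t ∈ A := Iff.rfl

theorem inter_eq_inter_iff {α : Type*} {A B K : Set α} :
    A ∩ K = B ∩ K ↔ ∀ x ∈ K, x ∈ A ↔ x ∈ B := by
  simp only [Set.ext_iff, mem_inter_iff, and_congr_left_iff]

variable [TopologicalSpace G]

theorem inHull_iff {Λ A : Set G} :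
    InHull Λ A ↔ ∀ K : Set G, IsCompact K → ∃ t : G, ∀ x ∈ K, x ∈ A ↔ x + t ∈ Λ := by
  simp only [InHull, inter_eq_inter_iff, mem_translateSet]

theorem InHull.refl (Λ : Set G) : InHull Λ Λ := (Hull.base Λ).inHull

theorem InHull.sub_subset {Λ A : Set G} (h : InHull Λ A) : A - A ⊆ Λ - Λ := by
  rintro _ ⟨a, ha, b, hb, rfl⟩
  obtain ⟨t, ht⟩ := inHull_iff.1 h {a, b} (Set.toFinite _).isCompact
  exact ⟨a + t, (ht a (by simp)).1 ha, b + t, (ht b (by simp)).1 hb, by simp⟩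

/-- A set all of whose bounded parts are finite. -/
def IsLocallyFiniteSet (S : Set G) : Prop := ∀ K : Set G, IsCompact K → (S ∩ K).Finite

theorem IsLocallyFiniteSet.mono {S T : Set G} (h : IsLocallyFiniteSet S) (hT : T ⊆ S) :
    IsLocallyFiniteSet T :=
  fun K hK => (h K hK).subset (inter_subset_inter_left _ hT)

variable [IsTopologicalAddGroup G]

theorem isCompact_sub {K L : Set G} (hK : IsCompact K) (hL : IsCompact L) : IsCompact (K - L) := by
  rw [sub_eq_add_neg]
  exact hK.add hL.neg

theorem IsLocallyFiniteSet.add_finite {S F : Set G} (h : IsLocallyFiniteSet S) (hF : F.Finite) :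
    IsLocallyFiniteSet (S + F) := by
  intro K hK
  refine ((h (K - F) (isCompact_sub hK hF.isCompact)).add hF).subset ?_
  rintro _ ⟨⟨s, hs, f, hf, rfl⟩, hx⟩
  exact ⟨s, ⟨hs, _, hx, f, hf, by simp⟩, f, hf, rfl⟩

theorem IsUniformlyDiscrete.isLocallyFiniteSet {S : Set G} (h : IsUniformlyDiscrete S) :
    IsLocallyFiniteSet S := by
  obtain ⟨U, hU, hS⟩ := h
  obtain ⟨V, hV, hVU⟩ := exists_nhds_half_neg hU
  intro K hK
  obtain ⟨t, -, hKt⟩ := hK.elim_nhds_subcover (fun x => {y | y - x ∈ V}) (fun x _ => by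
    have : Tendsto (fun y : G => y - x) (𝓝 x) (𝓝 0) := by
      simpa using (continuous_sub_right x).tendsto x
    exact this hV)
  refine (t.finite_toSet.biUnion (t := fun x => S ∩ {y | y - x ∈ V}) fun x _ => ?_).subset ?_
  · refine Set.Subsingleton.finite ?_
    rintro a ⟨haS, ha⟩ b ⟨hbS, hb⟩
    refine hS a haS b hbS ?_
    simpa using hVU _ ha _ hb
  · rintro y ⟨hyS, hyK⟩
    obtain ⟨x, hx, hy⟩ := mem_iUnion₂.1 (hKt hyK)
    exact mem_iUnion₂.2 ⟨x, hx, hyS, hy⟩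

theorem IsLocallyFiniteSet.isClosed [LocallyCompactSpace G] [T2Space G] {S : Set G}
    (h : IsLocallyFiniteSet S) : IsClosed S := by
  refine isClosed_of_closure_subset fun x hx => ?_
  obtain ⟨C, hC, hxC⟩ := exists_compact_mem_nhds x
  have hmem : x ∈ closure (S ∩ C) := by
    rw [mem_closure_iff_nhds] at hx ⊢
    intro U hU
    obtain ⟨y, ⟨hyU, hyC⟩, hyS⟩ := hx _ (inter_mem hU hxC)
    exact ⟨y, hyU, hyS, hyC⟩
  rw [(h C hC).isClosed.closure_eq] at hmem
  exact hmem.1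

/-- In a locally finite set, a neighbourhood of `0` contains no nonzero point. -/
theorem IsLocallyFiniteSet.exists_nhds_zero [LocallyCompactSpace G] [T2Space G] {S : Set G}
    (h : IsLocallyFiniteSet S) : ∃ U ∈ 𝓝 (0 : G), ∀ x ∈ S, x ∈ U → x = 0 := by
  have hc : IsClosed (S \ {0}) := (h.mono sdiff_subset).isClosed
  refine ⟨_, hc.isOpen_compl.mem_nhds (by simp), fun x hx hxU => ?_⟩
  by_contra h0
  exact hxU ⟨hx, h0⟩

theorem IsMeyer.nonempty {Λ : Set G} (h : IsMeyer Λ) : Λ.Nonempty := by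
  obtain ⟨K, -, hK⟩ := h.relativelyDense
  obtain ⟨s, hs, -⟩ := hK 0
  exact ⟨s, hs⟩

theorem IsMeyer.exists_sub_subset {Λ : Set G} (h : IsMeyer Λ) :
    ∃ F : Set G, F.Finite ∧ Λ - Λ ⊆ Λ + F := by
  obtain ⟨F, hF, hsub⟩ := h.diff_subset
  refine ⟨F, hF, ?_⟩
  rintro _ ⟨x, hx, y, hy, rfl⟩
  obtain ⟨z, hz, f, hf, e⟩ := hsub x hx y hy
  exact ⟨z, hz, f, hf, e.symm⟩

/-- Iterating `Λ - Λ ⊆ Λ + F` keeps second differences inside finitely many translates of `Λ`. -/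
theorem IsMeyer.isLocallyFiniteSet_sub_sub {Λ : Set G} (h : IsMeyer Λ) :
    IsLocallyFiniteSet ((Λ - Λ) - (Λ - Λ)) := by
  obtain ⟨F, hF, hsub⟩ := h.exists_sub_subset
  refine (h.uniformlyDiscrete.isLocallyFiniteSet.add_finite (hF.add (hF.sub hF))).mono ?_
  calc (Λ - Λ) - (Λ - Λ) ⊆ (Λ + F) - (Λ + F) := sub_subset_sub hsub hsub
    _ = (Λ - Λ) + (F - F) := by rw [add_sub_add_comm]
    _ ⊆ (Λ + F) + (F - F) := add_subset_add_right hsub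
    _ = Λ + (F + (F - F)) := add_assoc _ _ _

theorem IsMeyer.isLocallyFiniteSet_sub {Λ : Set G} (h : IsMeyer Λ) :
    IsLocallyFiniteSet (Λ - Λ) := by
  obtain ⟨F, hF, hsub⟩ := h.exists_sub_subset
  exact (h.uniformlyDiscrete.isLocallyFiniteSet.add_finite hF).mono hsub

theorem IsMeyer.isLocallyFiniteSet_add_sub {Λ : Set G} (h : IsMeyer Λ) :
    IsLocallyFiniteSet (Λ + (Λ - Λ)) := by
  obtain ⟨a, ha⟩ := h.nonempty
  refine (h.isLocallyFiniteSet_sub_sub.add_finite (Set.finite_singleton a)).mono ?_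
  rintro _ ⟨x, hx, _, ⟨y, hy, z, hz, rfl⟩, rfl⟩
  exact ⟨(x - a) - (z - y), ⟨_, ⟨x, hx, a, ha, rfl⟩, _, ⟨z, hz, y, hy, rfl⟩, rfl⟩, a, rfl, by
    simp only; abel⟩

/-- A compact set meeting every translate of the given relatively dense set. -/
theorem IsRelativelyDense.exists_compact {S : Set G} (h : IsRelativelyDense S) :
    ∃ K : Set G, IsCompact K ∧ ∀ t : G, ∃ k ∈ K, k + t ∈ S := by
  obtain ⟨K, hK, hS⟩ := h
  refine ⟨-K, hK.neg, fun t => ?_⟩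
  obtain ⟨s, hs, k, hk, rfl⟩ := hS t
  exact ⟨-k, by simpa using hk, by simpa using hs⟩

theorem InHull.isMeyer {Λ A : Set G} (h : InHull Λ A) (hΛ : IsMeyer Λ) : IsMeyer A := by
  have hsub := h.sub_subset
  have hrd : ∃ K : Set G, IsCompact K ∧ ∀ x : G, ∃ s ∈ A, ∃ k ∈ K, x = s + k := by
    obtain ⟨K, hK, hd⟩ := hΛ.relativelyDense
    refine ⟨K, hK, fun x => ?_⟩
    obtain ⟨t, ht⟩ := inHull_iff.1 h ({x} - K) (isCompact_sub isCompact_singleton hK)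
    obtain ⟨s, hs, k, hk, e⟩ := hd (x + t)
    have e' : x - k + t = s := by rw [sub_add_eq_add_sub, e, add_sub_cancel_right]
    exact ⟨x - k, (ht _ ⟨x, rfl, k, hk, rfl⟩).2 (by rwa [e']), k, hk, by abel⟩
  refine ⟨?_, hrd, ?_⟩
  · obtain ⟨U, hU, hd⟩ := hΛ.uniformlyDiscrete
    refine ⟨U, hU, fun x hx y hy hxy => ?_⟩
    obtain ⟨p, hp, q, hq, e⟩ := hsub ⟨x, hx, y, hy, rfl⟩
    simp only at e
    have := hd p hp q hq (by rwa [e])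
    rw [this, sub_self] at e
    exact (sub_eq_zero.1 e.symm)
  · obtain ⟨K, hK, hd⟩ := hrd
    obtain ⟨a, ha, -⟩ := hd 0
    -- If `z ∈ A` is within `k ∈ K` of `x - y`, then `k + a = (x - y) - (z - a)` is a second
    -- difference of `Λ` in a fixed compact set, so only finitely many `k` occur.
    have hfin := hΛ.isLocallyFiniteSet_sub_sub (K + {a}) (hK.add isCompact_singleton)
    refine ⟨_, hfin.sub (Set.finite_singleton a), fun x hx y hy => ?_⟩
    obtain ⟨z, hz, k, hk, e⟩ := hd (x - y)
    refine ⟨z, hz, k, ⟨k + a, ⟨?_, k, hk, a, rfl, rfl⟩, a, rfl, by simp⟩, e⟩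
    refine ⟨x - y, hsub ⟨x, hx, y, hy, rfl⟩, z - a, hsub ⟨z, hz, a, ha, rfl⟩, ?_⟩
    simp only [e]; abel

/-- Every patch of a repetitive set occurs relatively densely in every element of its hull. -/
theorem InHull.isRelativelyDense_occurrences {Λ A : Set G} (hA : InHull Λ A)
    (hΛ : IsRepetitive Λ) {K : Set G} (hK : IsCompact K) (t : G) :
    IsRelativelyDense {s | ∀ x ∈ K, x + s ∈ A ↔ x + t ∈ Λ} := by
  obtain ⟨C, hC, hd⟩ := hΛ (K + {t}) (hK.add isCompact_singleton)
  refine ⟨C, hC, fun g => ?_⟩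
  obtain ⟨r, hr⟩ := inHull_iff.1 hA (K + ({g} - C)) (hK.add (isCompact_sub isCompact_singleton hC))
  obtain ⟨s, hs, c, hc, e⟩ := hd (g + r - t)
  have e1 : g = s + c - r + t := by rw [← e]; abel
  refine ⟨g - c, fun x hx => ?_, c, hc, by abel⟩
  rw [hr _ ⟨x, hx, g - c, ⟨g, rfl, c, hc, rfl⟩, rfl⟩]
  have := inter_eq_inter_iff.1 hs (x + t) ⟨x, hx, t, rfl, rfl⟩
  rw [mem_translateSet] at this
  rw [← this]
  have e2 : x + (g - c) + r = x + t + s := by rw [e1]; abel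
  rw [e2]

theorem InHull.isRepetitive {Λ A : Set G} (hA : InHull Λ A) (hΛ : IsRepetitive Λ) :
    IsRepetitive A := by
  intro K hK
  obtain ⟨t, ht⟩ := inHull_iff.1 hA K hK
  obtain ⟨C, hC, hd⟩ := hA.isRelativelyDense_occurrences hΛ hK t
  refine ⟨C, hC, fun x => ?_⟩
  obtain ⟨s, hs, k, hk, e⟩ := hd x
  exact ⟨s, inter_eq_inter_iff.2 fun y hy => (hs y hy).trans (ht y hy).symm, k, hk, e⟩

/-- This is the minimality of the hull of a repetitive set. -/
theorem InHull.inHull_of_isRepetitive {Λ A B : Set G} (hA : InHull Λ A) (hΛ : IsRepetitive Λ)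
    (hB : InHull Λ B) : InHull A B := by
  refine inHull_iff.2 fun K hK => ?_
  obtain ⟨t, ht⟩ := inHull_iff.1 hB K hK
  obtain ⟨C, -, hd⟩ := hA.isRelativelyDense_occurrences hΛ hK t
  obtain ⟨s, hs, -⟩ := hd 0
  exact ⟨s, fun x hx => (ht x hx).trans (hs x hx).symm⟩

end Patches

/-! ### Topology and compactness of the hull. -/

section HullTopology

variable {G : Type u} [AddCommGroup G] [TopologicalSpace G] [IsTopologicalAddGroup G]

theorem Hull.carrier_vadd {Λ : Set G} (t : G) (A : Hull Λ) :
    (t +ᵥ A).carrier = translateSet A.carrier t := rfl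

theorem mem_hullEntourage {Λ K U : Set G} {A B : Hull Λ} :
    (A, B) ∈ hullEntourage Λ K U ↔
      ∃ t ∈ U, ∃ t' ∈ U, ∀ x ∈ K, x + t ∈ A.carrier ↔ x + t' ∈ B.carrier := by
  simp only [hullEntourage, inter_eq_inter_iff, mem_translateSet]
  rfl

variable [LocallyCompactSpace G]

theorem mem_uniformity_hull {Λ : Set G} {S : Set (Hull Λ × Hull Λ)} :
    S ∈ uniformity (Hull Λ) ↔
      ∃ K U : Set G, IsCompact K ∧ U ∈ 𝓝 (0 : G) ∧ hullEntourage Λ K U ⊆ S :=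
  Iff.rfl

theorem hullEntourage_mem_uniformity (Λ : Set G) {K U : Set G} (hK : IsCompact K)
    (hU : U ∈ 𝓝 (0 : G)) : hullEntourage Λ K U ∈ uniformity (Hull Λ) :=
  mem_uniformity_hull.2 ⟨K, U, hK, hU, Subset.rfl⟩

theorem Hull.continuous_vadd {Λ : Set G} (t : G) : Continuous fun A : Hull Λ => t +ᵥ A := by
  refine UniformContinuous.continuous fun S hS => ?_
  obtain ⟨K, U, hK, hU, hS⟩ := mem_uniformity_hull.1 hS
  refine mem_uniformity_hull.2 ⟨K + {t}, U, hK.add isCompact_singleton, hU, ?_⟩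
  rintro ⟨A, B⟩ h
  obtain ⟨s, hs, s', hs', h⟩ := mem_hullEntourage.1 h
  refine hS (mem_hullEntourage.2 ⟨s, hs, s', hs', fun x hx => ?_⟩)
  have := h (x + t) ⟨x, hx, t, rfl, rfl⟩
  rwa [Hull.carrier_vadd, Hull.carrier_vadd, mem_translateSet, mem_translateSet,
    add_right_comm, add_right_comm x s' t]

theorem Hull.denseRange_vadd {Λ : Set G} (x : Hull Λ)
    (hx : ∀ B : Hull Λ, InHull x.carrier B.carrier) : DenseRange fun t : G => t +ᵥ x := by
  intro B
  rw [mem_closure_iff_nhds]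
  intro N hN
  obtain ⟨S, hS, hSN⟩ := UniformSpace.mem_nhds_iff.1 hN
  obtain ⟨K, U, hK, hU, hS⟩ := mem_uniformity_hull.1 hS
  obtain ⟨t, ht⟩ := inHull_iff.1 (hx B) K hK
  refine ⟨t +ᵥ x, hSN (hS (mem_hullEntourage.2
    ⟨0, mem_of_mem_nhds hU, 0, mem_of_mem_nhds hU, fun y hy => ?_⟩)), t, rfl⟩
  simpa [Hull.carrier_vadd, mem_translateSet] using ht y hy

/-- Each `B` has a point `b B` in a fixed compact set, which converges to some `c` along an
ultrafilter. The recentred sets `B - b B` lie in the locally finite set `Λ - Λ`, so they stabilise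
on compact sets to some `D`, and the limit is `D + c`. -/
theorem Hull.compactSpace {Λ : Set G} (hΛ : IsMeyer Λ) : CompactSpace (Hull Λ) := by
  obtain ⟨C, hC, hd⟩ := hΛ.relativelyDense.exists_compact
  have hne : ∀ B : Hull Λ, ∃ b ∈ C, b ∈ B.carrier := fun B => by
    obtain ⟨t, ht⟩ := inHull_iff.1 B.inHull C hC
    obtain ⟨k, hk, hkt⟩ := hd t
    exact ⟨k, hk, (ht k hk).2 hkt⟩
  choose b hbC hb using hne
  refine ⟨isCompact_iff_ultrafilter_le_nhds.2 fun F _ => ?_⟩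
  obtain ⟨c, -, hc⟩ := isCompact_iff_ultrafilter_le_nhds.1 hC (F.map b)
    (le_principal_iff.2 (Filter.mem_map.2 (Filter.mem_of_superset univ_mem fun B _ => hbC B)))
  replace hc : Tendsto b F (𝓝 c) := hc
  set D : Set G := {d | ∀ᶠ B in (F : Filter (Hull Λ)), d + b B ∈ B.carrier} with hD
  have key : ∀ K : Set G, IsCompact K → ∀ᶠ B in (F : Filter (Hull Λ)),
      ∀ d ∈ K, d ∈ D ↔ d + b B ∈ B.carrier := by
    intro K hK
    have hfin := hΛ.isLocallyFiniteSet_sub K hK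
    have h1 : ∀ᶠ B in (F : Filter (Hull Λ)), ∀ d ∈ (Λ - Λ) ∩ K, d ∈ D ↔ d + b B ∈ B.carrier := by
      refine (Filter.eventually_all_finite hfin).2 fun d _ => ?_
      by_cases hd : d ∈ D
      · filter_upwards [hd] with B hB using by simp [hd, hB]
      · have := Ultrafilter.eventually_not.2 hd
        filter_upwards [this] with B hB using by simp [hd, hB]
    have hsub : ∀ B : Hull Λ, ∀ d, d + b B ∈ B.carrier → d ∈ Λ - Λ := fun B d h =>
      B.inHull.sub_subset ⟨d + b B, h, b B, hb B, by simp⟩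
    filter_upwards [h1] with B hB d hdK
    by_cases hdΛ : d ∈ Λ - Λ
    · exact hB d ⟨hdΛ, hdK⟩
    · refine ⟨fun h => ?_, fun h => absurd (hsub B d h) hdΛ⟩
      obtain ⟨B', hB'⟩ := (show ∀ᶠ B in (F : Filter (Hull Λ)), d + b B ∈ B.carrier from h).exists
      exact absurd (hsub B' d hB') hdΛ
  have hin : InHull Λ (translateSet D (-c)) := by
    refine inHull_iff.2 fun K hK => ?_
    obtain ⟨B, hB⟩ := (key (K + {-c}) (hK.add isCompact_singleton)).exists
    obtain ⟨t, ht⟩ := inHull_iff.1 B.inHull (K + {-c} + {b B})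
      ((hK.add isCompact_singleton).add isCompact_singleton)
    refine ⟨-c + b B + t, fun x hx => ?_⟩
    have hx' : x + -c ∈ K + {-c} := ⟨x, hx, -c, rfl, rfl⟩
    rw [mem_translateSet, hB _ hx', ht _ ⟨_, hx', b B, rfl, rfl⟩]
    simp only [add_assoc]
  refine ⟨⟨_, hin⟩, mem_univ _, fun N hN => ?_⟩
  obtain ⟨S, hS, hSN⟩ := UniformSpace.mem_nhds_iff.1 hN
  obtain ⟨K, U, hK, hU, hS⟩ := mem_uniformity_hull.1 hS
  have hcU : ∀ᶠ B in (F : Filter (Hull Λ)), b B - c ∈ U :=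
    (hc.sub_const c).eventually_mem (by simpa using hU)
  refine mem_of_superset ((key _ (hK.add (isCompact_singleton (x := -c)))).and hcU)
    fun B hB => hSN (hS ?_)
  refine mem_hullEntourage.2 ⟨0, mem_of_mem_nhds hU, b B - c, hB.2, fun x hx => ?_⟩
  have := hB.1 (x + -c) ⟨x, hx, -c, rfl, rfl⟩
  rw [add_zero, mem_translateSet, this, show x + (b B - c) = x + -c + b B by abel]

end HullTopology

theorem exists_nhds_preimage_subset {X : Type v} {Y : Type w} [TopologicalSpace X] [CompactSpace X]
    [TopologicalSpace Y] [T2Space Y] {π : X → Y} (hπ : Continuous π) {x : X}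
    (hx : ∀ x', π x' = π x → x' = x) {N : Set X} (hN : N ∈ 𝓝 x) :
    ∃ M ∈ 𝓝 (π x), π ⁻¹' M ⊆ N := by
  obtain ⟨O, hO, hOo, hxO⟩ := mem_nhds_iff.1 hN
  have hcl : IsClosed (π '' Oᶜ) := (hOo.isClosed_compl.isCompact.image hπ).isClosed
  refine ⟨_, hcl.isOpen_compl.mem_nhds ?_, fun B hB => hO ?_⟩
  · rintro ⟨B, hB, e⟩
    exact hB (hx B e ▸ hxO)
  · by_contra hBO
    exact hB ⟨B, hBO, rfl⟩

/-! ### Patch rigidity. -/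

section Rigidity

variable {G : Type u} [AddCommGroup G] [TopologicalSpace G]

/-- If two translates of `A` agree on a large compact set, then their difference is a return time
of `A` to a prescribed compact set. -/
def IsPatchRigid (A : Set G) : Prop :=
  ∀ K : Set G, IsCompact K → ∃ K' : Set G, IsCompact K' ∧
    ∀ s t : G, (∀ x ∈ K', x + s ∈ A ↔ x + t ∈ A) → ∀ x ∈ K, x + (t - s) ∈ A ↔ x ∈ A

end Rigidity

/-! ### Cut and project sets and the topology pulled back from the internal space. -/

section CutAndProject

variable {G : Type u} [AddCommGroup G] {H : Type w} [AddCommGroup H] {Γ : AddSubgroup (H × G)}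

theorem cutAndProject_mono {V W : Set H} (h : V ⊆ W) : cutAndProject Γ V ⊆ cutAndProject Γ W :=
  fun _ ⟨t', ht, hV⟩ => ⟨t', ht, h hV⟩

theorem add_mem_cutAndProject {V W : Set H} {a b : G} (ha : a ∈ cutAndProject Γ V)
    (hb : b ∈ cutAndProject Γ W) : a + b ∈ cutAndProject Γ (V + W) := by
  obtain ⟨a', ha, haV⟩ := ha
  obtain ⟨b', hb, hbW⟩ := hb
  exact ⟨a' + b', Γ.add_mem ha hb, a', haV, b', hbW, rfl⟩

theorem neg_mem_cutAndProject {V : Set H} {a : G} (ha : a ∈ cutAndProject Γ V) :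
    -a ∈ cutAndProject Γ (-V) := by
  obtain ⟨a', ha, haV⟩ := ha
  exact ⟨-a', Γ.neg_mem ha, by simpa using haV⟩

theorem sub_mem_cutAndProject {V W : Set H} {a b : G} (ha : a ∈ cutAndProject Γ V)
    (hb : b ∈ cutAndProject Γ W) : a - b ∈ cutAndProject Γ (V - W) := by
  rw [sub_eq_add_neg, sub_eq_add_neg]
  exact add_mem_cutAndProject ha (neg_mem_cutAndProject hb)

variable [TopologicalSpace H] [IsTopologicalAddGroup H]

theorem exists_finite_cover_of_subset_cutAndProject {C V : Set H} (hC : IsCompact C)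
    (hV : V ∈ 𝓝 (0 : H)) {S : Set G} (hS : S ⊆ cutAndProject Γ C) :
    ∃ F : Set G, F.Finite ∧ F ⊆ S ∧ ∀ s ∈ S, ∃ f ∈ F, s - f ∈ cutAndProject Γ V := by
  obtain ⟨V', hV', hVV⟩ := exists_nhds_half_neg hV
  obtain ⟨t, -, ht⟩ := hC.elim_nhds_subcover (fun x => {y | y - x ∈ V'}) (fun x _ => by
    have : Tendsto (fun y : H => y - x) (𝓝 x) (𝓝 0) := by
      simpa using (continuous_sub_right x).tendsto x
    exact this hV')
  let P : H → G → Prop := fun j g => g ∈ S ∧ ∃ h, (h, g) ∈ Γ ∧ h - j ∈ V'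
  have hP : ∀ j, ∃ g, (∃ g', P j g') → P j g := fun j => by
    by_cases h : ∃ g', P j g'
    -- In the other case the value `0` is junk: only indices with a genuine witness enter the finite
    -- set.
    · exact ⟨h.choose, fun _ => h.choose_spec⟩
    · exact ⟨0, fun h' => absurd h' h⟩
  choose p hp using hP
  refine ⟨p '' {j | j ∈ t ∧ ∃ g', P j g'},
    (t.finite_toSet.subset fun j hj => hj.1).image p, ?_, fun s hs => ?_⟩
  · rintro _ ⟨j, ⟨-, hj⟩, rfl⟩
    exact (hp j hj).1
  · obtain ⟨h, hΓ, hC'⟩ := hS hs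
    obtain ⟨j, hjt, hj⟩ := mem_iUnion₂.1 (ht hC')
    have hex : ∃ g', P j g' := ⟨s, hs, h, hΓ, hj⟩
    obtain ⟨-, h', hΓ', hj'⟩ := hp j hex
    refine ⟨p j, ⟨j, ⟨hjt, hex⟩, rfl⟩, h - h', Γ.sub_mem hΓ hΓ', ?_⟩
    simpa using hVV _ hj _ hj'

variable [TopologicalSpace G] [IsTopologicalAddGroup G]

theorem IsLattice.isRelativelyDense_cutAndProject (hΓ : IsLattice Γ) {V : Set H}
    (hV : V ∈ 𝓝 (0 : H)) : IsRelativelyDense (cutAndProject Γ V) := by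
  obtain ⟨C, hC, hd⟩ := hΓ.2
  obtain ⟨F, hF, -, hcov⟩ := exists_finite_cover_of_subset_cutAndProject (Γ := Γ)
    (hC.image continuous_fst).neg hV Subset.rfl
  refine ⟨Prod.snd '' C + F, (hC.image continuous_snd).add hF.isCompact, fun g => ?_⟩
  obtain ⟨γ, hγ, c, hc, e⟩ := hd (0, g)
  have e1 : γ.1 = -c.1 := eq_neg_of_add_eq_zero_left (congrArg Prod.fst e).symm
  have e2 : g = γ.2 + c.2 := congrArg Prod.snd e
  obtain ⟨f, hf, hfV⟩ := hcov γ.2 ⟨γ.1, hγ, by rw [e1]; simpa using ⟨c.2, hc⟩⟩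
  exact ⟨_, hfV, c.2 + f, ⟨c.2, ⟨c, hc, rfl⟩, f, hf, rfl⟩, by rw [e2]; abel⟩

variable [LocallyCompactSpace H] [T2Space H] [LocallyCompactSpace G] [T2Space G]

/-- A lift of an inside point lies in the interior of `W`, since it avoids the boundary. The
projection of `Γ` to `G` need not be injective, so for an outside point it is the whole fibre,
closed because `Γ` is, that must be separated from the compact `W`. -/
theorem IsLattice.cutAndProject_clopen (hΓ : IsLattice Γ) {W : Set H} (hW : IsCompact W)
    (hfr : ∀ γ ∈ Γ, γ.1 ∉ frontier W) (g : G) :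
    ∃ V ∈ 𝓝 (0 : H), ∀ v ∈ cutAndProject Γ V,
      g + v ∈ cutAndProject Γ W ↔ g ∈ cutAndProject Γ W := by
  by_cases hg : g ∈ cutAndProject Γ W
  · obtain ⟨h, hh, hhW⟩ := hg
    have hint : W ∈ 𝓝 h := by
      rw [← mem_interior_iff_mem_nhds]
      by_contra hn
      exact hfr _ hh ⟨subset_closure hhW, hn⟩
    have : Tendsto (fun y : H => h + y) (𝓝 0) (𝓝 h) := by
      simpa using (continuous_const_add h).tendsto 0
    refine ⟨_, this hint, fun v hv => ⟨fun _ => ⟨h, hh, hhW⟩, fun _ => ?_⟩⟩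
    obtain ⟨v', hv', hvW⟩ := hv
    exact ⟨h + v', Γ.add_mem hh hv', hvW⟩
  · have hcl : IsClosed (Γ : Set (H × G)) := hΓ.1.isLocallyFiniteSet.isClosed
    have hM : IsClosed {h : H | (h, g) ∈ Γ} :=
      hcl.preimage (f := fun h : H => (h, g)) (by fun_prop)
    obtain ⟨V, hV, hVM⟩ := compact_open_separated_add_right hW hM.isOpen_compl
      (fun w hw hwM => hg ⟨w, hwM, hw⟩)
    refine ⟨-V, neg_mem_nhds_zero H hV, fun v hv => ⟨fun h => ?_, fun h => absurd h hg⟩⟩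
    obtain ⟨v', hv', hvV⟩ := hv
    obtain ⟨w, hw, hwW⟩ := h
    refine absurd ?_ (hVM ⟨w, hwW, -v', hvV, rfl⟩)
    simpa [sub_eq_add_neg] using! Γ.sub_mem hw hv'

/-- Near every point, one finds a whole neighbourhood of a fixed size on which membership in the
cut and project set is constant. -/
theorem IsLattice.cutAndProject_uniform (hΓ : IsLattice Γ) {W : Set H} (hW : IsCompact W)
    (hfr : ∀ γ ∈ Γ, γ.1 ∉ frontier W) {V : Set H} (hV : V ∈ 𝓝 (0 : H)) :
    ∃ V' ∈ 𝓝 (0 : H), ∀ z : G, ∃ p : G, p - z ∈ cutAndProject Γ V ∧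
      ∀ v ∈ cutAndProject Γ V', p + v ∈ cutAndProject Γ W ↔ z ∈ cutAndProject Γ W := by
  obtain ⟨C, hC, hC0⟩ := exists_compact_mem_nhds (0 : H)
  choose N hN hNA using hΓ.cutAndProject_clopen hW hfr
  have hV' := neg_mem_nhds_zero H hV
  obtain ⟨F, hF, hFS, hcov⟩ := exists_finite_cover_of_subset_cutAndProject hW hV'
    (Subset.refl (cutAndProject Γ W))
  -- Outside points need centres only near `W`. Those outside `W - C` are their own centres, because
  -- shifts by internal coordinates in `C` cannot bring them into `W`.
  obtain ⟨F', hF', hFS', hcov'⟩ := exists_finite_cover_of_subset_cutAndProject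
    (isCompact_sub hW hC) hV' (S := cutAndProject Γ (W - C) \ cutAndProject Γ W) sdiff_subset
  have hneg : ∀ {z f : G}, z - f ∈ cutAndProject Γ (-V) → f - z ∈ cutAndProject Γ V := by
    intro z f h
    simpa using neg_mem_cutAndProject h
  refine ⟨((⋂ f ∈ F, N f) ∩ ⋂ f ∈ F', N f) ∩ C,
    inter_mem (inter_mem ((biInter_mem hF).2 fun f _ => hN f)
      ((biInter_mem hF').2 fun f _ => hN f)) hC0, fun z => ?_⟩
  by_cases hz : z ∈ cutAndProject Γ W
  · obtain ⟨f, hf, hzf⟩ := hcov z hz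
    refine ⟨f, hneg hzf, fun v hv => ?_⟩
    rw [hNA f v (cutAndProject_mono (fun x hx => mem_iInter₂.1 hx.1.1 f hf) hv)]
    exact iff_of_true (hFS hf) hz
  · by_cases hzC : z ∈ cutAndProject Γ (W - C)
    · obtain ⟨f, hf, hzf⟩ := hcov' z ⟨hzC, hz⟩
      refine ⟨f, hneg hzf, fun v hv => ?_⟩
      rw [hNA f v (cutAndProject_mono (fun x hx => mem_iInter₂.1 hx.1.2 f hf) hv)]
      exact iff_of_false (hFS' hf).2 hz
    · refine ⟨z, ⟨0, by rw [sub_self]; exact Γ.zero_mem, mem_of_mem_nhds hV⟩, fun v hv => iff_of_false (fun h => hzC ?_) hz⟩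
      simpa using sub_mem_cutAndProject h (cutAndProject_mono inter_subset_right hv)

end CutAndProject

/-! ### Rigidity of model sets and of points with a one-point fibre. -/

section Rigidity

variable {G : Type u} [AddCommGroup G] [TopologicalSpace G] [IsTopologicalAddGroup G]
  [LocallyCompactSpace G] [T2Space G]

theorem IsNonsingularModelSet.isPatchRigid {A : Set G} (hA : IsNonsingularModelSet A)
    (hM : IsMeyer A) : IsPatchRigid A := by
  obtain ⟨H, _, _, _, _, _, Γ, W, hΓ, hW, -, hfr, e⟩ := hA
  intro K hK
  choose N hN hNA using hΓ.cutAndProject_clopen hW hfr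
  rw [← e] at hNA
  have hfin := hM.isLocallyFiniteSet_add_sub K hK
  obtain ⟨V₁, hV₁, hVV⟩ := exists_nhds_zero_half ((biInter_mem hfin).2 fun g _ => hN g)
  obtain ⟨V₂, hV₂, hp⟩ := hΓ.cutAndProject_uniform hW hfr hV₁
  rw [← e] at hp
  obtain ⟨K₁, hK₁, hd₁⟩ :=
    (hΓ.isRelativelyDense_cutAndProject (inter_mem hV₁ hV₂)).exists_compact
  obtain ⟨K₂, hK₂, hd₂⟩ := hM.relativelyDense.exists_compact
  refine ⟨K₁ ∪ K₂, hK₁.union hK₂, fun s t hst g hg => ?_⟩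
  have hc : t - s ∈ A - A := by
    obtain ⟨k, hk, hks⟩ := hd₂ s
    exact ⟨k + t, (hst k (Or.inr hk)).1 hks, k + s, hks, by simp⟩
  by_cases hgF : g ∈ A + (A - A)
  -- The idea is to find `r` in `K₁` such that, internally, `r + t` is close to `g + (t - s)` and `r
  -- + s` is close to `g`; agreement at `r` then transfers to `g`. The radius at `g` is uniform
  -- because only finitely many `g` in `K` matter, while the centre `p` avoids a radius depending on
  -- `t - s`.
  · obtain ⟨p, hpV, hpA⟩ := hp (g + (t - s))
    obtain ⟨r, hr, hrV⟩ := hd₁ (s - (p - (t - s)))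
    have h1 := hst r (Or.inl hr)
    have h2 := hpA _ (cutAndProject_mono inter_subset_right hrV)
    have h3 := hNA g _ (cutAndProject_mono (fun x hx => mem_iInter₂.1
      (show x ∈ ⋂ i ∈ (A + (A - A)) ∩ K, N i from by
        obtain ⟨a, ha, b, hb, rfl⟩ := hx
        exact hVV a ha b hb) g ⟨hgF, hg⟩)
      (add_mem_cutAndProject hpV (cutAndProject_mono inter_subset_left hrV)))
    rw [← h2, ← h3, show p + (r + (s - (p - (t - s)))) = r + t by abel,
      show g + (p - (g + (t - s)) + (r + (s - (p - (t - s))))) = r + s by abel, h1]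
  · refine iff_of_false (fun h => hgF ?_) (fun h => hgF ?_)
    · obtain ⟨a, ha, b, hb, hab⟩ := hc
      exact ⟨g + (t - s), h, b - a, ⟨b, hb, a, ha, rfl⟩, by simp only [← hab]; abel⟩
    · exact ⟨g, h, 0, ⟨g, h, g, h, by simp⟩, by simp⟩

/-- If `s +ᵥ x` and `t +ᵥ x` are close, equicontinuity lets `-s` be applied to their images, so `π
((t - s) +ᵥ x)` is close to `π x`. The one-point fibre and compactness then put `(t - s) +ᵥ x` close
to `x`. Maximality of the factor plays no role. -/
theorem isPatchRigid_of_fiber_eq_singleton {Λ : Set G} (hΛ : IsMeyer Λ) {Y : Type v}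
    [UniformSpace Y] [T2Space Y] [AddAction G Y] {π : Hull Λ → Y} (hπ : IsFactorMap G π)
    (hY : IsEquicontinuousAction G Y) {x : Hull Λ} (hx : ∀ x', π x' = π x → x' = x) :
    IsPatchRigid x.carrier := by
  have := Hull.compactSpace hΛ
  set A := x.carrier with hAdef
  have hM : IsMeyer A := x.inHull.isMeyer hΛ
  intro K hK
  obtain ⟨a, ha⟩ := hM.nonempty
  obtain ⟨U₀, hU₀, hsmall⟩ := hM.isLocallyFiniteSet_sub_sub.exists_nhds_zero
  obtain ⟨U₁, hU₁, hUU⟩ := exists_nhds_half_neg hU₀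
  obtain ⟨C, hC, hC0⟩ := exists_compact_mem_nhds (0 : G)
  have hK₁ : IsCompact ((K ∪ {a}) - C) := isCompact_sub (hK.union isCompact_singleton) hC
  have hN := UniformSpace.ball_mem_nhds x
    (hullEntourage_mem_uniformity Λ hK₁ (inter_mem hU₁ hC0))
  obtain ⟨M, hMn, hMB⟩ := exists_nhds_preimage_subset hπ.continuous hx hN
  obtain ⟨E, hE, hEM⟩ := UniformSpace.mem_nhds_iff.1 hMn
  obtain ⟨K₂, U₂, hK₂, hU₂, h₂⟩ := mem_uniformity_hull.1
    (CompactSpace.uniformContinuous_of_continuous hπ.continuous (hY E hE))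
  obtain ⟨K₃, hK₃, hd⟩ := hM.relativelyDense.exists_compact
  refine ⟨K₂ ∪ K₃, hK₂.union hK₃, fun s t hst g hg => ?_⟩
  obtain ⟨c, hc⟩ : ∃ c, c = t - s := ⟨_, rfl⟩
  rw [← hc]
  have hcA : c ∈ A - A := by
    obtain ⟨k, hk, hks⟩ := hd s
    exact ⟨k + t, (hst k (Or.inr hk)).1 hks, k + s, hks, by simp [hc]⟩
  have h1 : ((s +ᵥ x, t +ᵥ x) : Hull Λ × Hull Λ) ∈ hullEntourage Λ K₂ U₂ :=
    mem_hullEntourage.2 ⟨0, mem_of_mem_nhds hU₂, 0, mem_of_mem_nhds hU₂, fun y hy => by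
      simpa [Hull.carrier_vadd, mem_translateSet] using hst y (Or.inl hy)⟩
  have h2 : (-s +ᵥ π (s +ᵥ x), -s +ᵥ π (t +ᵥ x)) ∈ E := h₂ h1 (-s)
  rw [← hπ.map_vadd, ← hπ.map_vadd, vadd_vadd, vadd_vadd, neg_add_cancel, zero_vadd,
    neg_add_eq_sub, ← hc] at h2
  obtain ⟨u, hu, u', hu', h3⟩ := mem_hullEntourage.1 (hMB (hEM h2))
  simp only [Hull.carrier_vadd, mem_translateSet, ← hAdef] at h3
  have h4 := (h3 (a - u) ⟨a, Or.inr rfl, u, hu.2, rfl⟩).1 (by simpa using ha)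
  -- Closeness in the hull allows two different small shifts. Matching them at `a` exhibits `u' - u`
  -- as a second difference of `A`, and `0` is isolated among these.
  have h5 : u' = u := by
    refine sub_eq_zero.1 (hsmall _ ⟨a - u + u' + c - a, ⟨_, h4, a, ha, rfl⟩, c, hcA, ?_⟩
      (hUU _ hu'.1 _ hu.1))
    simp only; abel
  have h6 := h3 (g - u) ⟨g, Or.inl hg, u, hu.2, rfl⟩
  rw [h5] at h6
  simpa using h6.symm

end Rigidity

/-! ### Completion of a group topology. -/

/-- The Hausdorff completion of an abelian group with respect to a group topology given by a
basis of neighbourhoods of `0`. -/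
theorem exists_completion {G : Type u} [AddCommGroup G] (𝓢 : Set (Set G)) (hne : 𝓢.Nonempty)
    (hinter : ∀ S ∈ 𝓢, ∀ T ∈ 𝓢, ∃ R ∈ 𝓢, R ⊆ S ∩ T) (hzero : ∀ S ∈ 𝓢, (0 : G) ∈ S)
    (hsub : ∀ S ∈ 𝓢, ∃ T ∈ 𝓢, T - T ⊆ S) :
    ∃ (H : Type u) (_ : AddCommGroup H) (_ : UniformSpace H) (_ : IsUniformAddGroup H)
      (_ : CompleteSpace H) (_ : T2Space H) (ι : G →+ H), DenseRange ι ∧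
      (∀ S ∈ 𝓢, ∃ V ∈ 𝓝 (0 : H), ι ⁻¹' V ⊆ S) ∧ ∀ V ∈ 𝓝 (0 : H), ∃ S ∈ 𝓢, S ⊆ ι ⁻¹' V := by
  let B : AddGroupFilterBasis G :=
    { sets := 𝓢
      nonempty := hne
      inter_sets := fun {S T} hS hT => hinter S hS T hT
      zero' := fun {S} hS => hzero S hS
      add' := fun {S} hS => by
        obtain ⟨T, hT, hTS⟩ := hsub S hS
        obtain ⟨R, hR, hRT⟩ := hsub T hT
        obtain ⟨Q, hQ, hQRT⟩ := hinter R hR T hT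
        refine ⟨Q, hQ, ?_⟩
        rintro _ ⟨a, ha, b, hb, rfl⟩
        exact hTS ⟨a, (hQRT ha).2, -b,
          hRT ⟨0, hzero R hR, b, (hQRT hb).1, by simp⟩, by simp⟩
      neg' := fun {S} hS => by
        obtain ⟨T, hT, hTS⟩ := hsub S hS
        exact ⟨T, hT, fun x hx => hTS ⟨0, hzero T hT, x, hx, by simp⟩⟩
      conj' := fun x S hS => ⟨S, hS, fun y hy => by simpa using hy⟩ }
  let : TopologicalSpace G := B.topology
  have : IsTopologicalAddGroup G := B.isTopologicalAddGroup
  let : UniformSpace G := IsTopologicalAddGroup.rightUniformSpace G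
  have : IsUniformAddGroup G := isUniformAddGroup_of_addCommGroup
  have hd := UniformSpace.Completion.isDenseInducing_toCompl G
  have hnhds : 𝓝 (0 : G) = comap (UniformSpace.Completion.toCompl (α := G)) (𝓝 0) := by
    rw [hd.nhds_eq_comap, map_zero]
  have hB : (𝓝 (0 : G)).HasBasis (fun S => S ∈ 𝓢) id := B.nhds_zero_hasBasis
  refine ⟨UniformSpace.Completion G, inferInstance, inferInstance, inferInstance, inferInstance,
    inferInstance, UniformSpace.Completion.toCompl, hd.dense, fun S hS => ?_, fun V hV => ?_⟩
  · have : S ∈ 𝓝 (0 : G) := hB.mem_of_mem hS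
    rw [hnhds] at this
    exact this
  · have : UniformSpace.Completion.toCompl ⁻¹' V ∈ 𝓝 (0 : G) := by
      rw [hnhds]
      exact preimage_mem_comap hV
    exact hB.mem_iff.1 this

/-! ### From rigidity to a model set. -/

section ReturnTimes

variable {G : Type u} [AddCommGroup G]

theorem mem_returnTimes {A K : Set G} {t : G} :
    t ∈ returnTimes A K ↔ ∀ x ∈ K, x + t ∈ A ↔ x ∈ A := by
  rw [returnTimes]
  exact inter_eq_inter_iff

theorem zero_mem_returnTimes (A K : Set G) : (0 : G) ∈ returnTimes A K :=
  mem_returnTimes.2 fun x _ => by rw [add_zero]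

theorem returnTimes_anti (A : Set G) {K L : Set G} (h : K ⊆ L) :
    returnTimes A L ⊆ returnTimes A K :=
  fun _ ht => mem_returnTimes.2 fun x hx => mem_returnTimes.1 ht x (h hx)

variable [TopologicalSpace G] [IsTopologicalAddGroup G]

theorem IsPatchRigid.exists_sub_subset {A : Set G} (hA : IsPatchRigid A) {K : Set G}
    (hK : IsCompact K) :
    ∃ K', IsCompact K' ∧ returnTimes A K' - returnTimes A K' ⊆ returnTimes A K := by
  obtain ⟨K', hK', h⟩ := hA K hK
  refine ⟨K', hK', ?_⟩
  rintro _ ⟨t, ht, s, hs, rfl⟩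
  exact mem_returnTimes.2 (h s t fun x hx =>
    (mem_returnTimes.1 hs x hx).trans (mem_returnTimes.1 ht x hx).symm)

/-- A Meyer set with rigid patches is covered by finitely many translates of each set of return
times. -/
theorem IsPatchRigid.exists_finite_cover {A : Set G} (hA : IsPatchRigid A) (hM : IsMeyer A)
    {K : Set G} (hK : IsCompact K) :
    ∃ F : Set G, F.Finite ∧ ∀ a ∈ A, ∃ f ∈ F, a - f ∈ returnTimes A K := by
  obtain ⟨K', hK', h⟩ := hA K hK
  have hfin := hM.isLocallyFiniteSet_sub K' hK'
  let P : G → Set G := fun a => {x ∈ K' | x + a ∈ A}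
  have hP : P '' A ⊆ 𝒫 ((A - A) ∩ K') := by
    rintro _ ⟨a, ha, rfl⟩ x ⟨hx, hxa⟩
    exact ⟨⟨x + a, hxa, a, ha, by simp⟩, hx⟩
  -- `A` shows finitely many patches of shape `K'` around its own points; `F` keeps one point for
  -- each.
  obtain ⟨F, -, hbij⟩ := exists_subset_bijOn A P
  have hF : F.Finite :=
    Set.Finite.of_finite_image (hbij.image_eq ▸ hfin.finite_subsets.subset hP) hbij.injOn
  refine ⟨F, hF, fun a ha => ?_⟩
  obtain ⟨f, hf, hfa⟩ : P a ∈ P '' F := hbij.image_eq ▸ mem_image_of_mem P ha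
  refine ⟨f, hf, mem_returnTimes.2 (h f a fun x hx => ?_)⟩
  have := Set.ext_iff.1 hfa x
  simpa [P, hx] using this

variable [LocallyCompactSpace G] [T2Space G]

/-- `H` is the completion of `G` for the return-time topology, the lattice is the graph of `ι`, and
the window is the closure of `ι '' A`. Return times to singletons make `A` clopen, so no `ι g` is on
the boundary. The finite covers of `A` make the window compact, and its nonempty interior then makes
`H` locally compact. -/
theorem IsPatchRigid.isNonsingularModelSet {A : Set G} (hA : IsPatchRigid A) (hM : IsMeyer A) :
    IsNonsingularModelSet A := by
  obtain ⟨H, _, _, _, _, _, ι, hι, hSV, hVS⟩ := exists_completion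
    {S | ∃ K, IsCompact K ∧ S = returnTimes A K} ⟨_, ∅, isCompact_empty, rfl⟩
    (by
      rintro _ ⟨K, hK, rfl⟩ _ ⟨L, hL, rfl⟩
      exact ⟨_, ⟨K ∪ L, hK.union hL, rfl⟩, subset_inter (returnTimes_anti A subset_union_left)
        (returnTimes_anti A subset_union_right)⟩)
    (by
      rintro _ ⟨K, -, rfl⟩
      exact zero_mem_returnTimes A K)
    (by
      rintro _ ⟨K, hK, rfl⟩
      obtain ⟨K', hK', h⟩ := hA.exists_sub_subset hK
      exact ⟨_, ⟨K', hK', rfl⟩, h⟩)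
  obtain ⟨a, ha⟩ := hM.nonempty
  have hopen : ∀ g : G, ∃ O : Set H, IsOpen O ∧ ι g ∈ O ∧ ∀ g', ι g' ∈ O → (g' ∈ A ↔ g ∈ A) := by
    intro g
    obtain ⟨V, hV, h⟩ := hSV _ ⟨{g}, isCompact_singleton, rfl⟩
    obtain ⟨O, hOV, hO, hO0⟩ := mem_nhds_iff.1 hV
    refine ⟨(fun h => h - ι g) ⁻¹' O, hO.preimage (continuous_sub_right _), by simpa using hO0,
      fun g' hg' => ?_⟩
    have hmem : g' - g ∈ returnTimes A {g} := h (show ι (g' - g) ∈ V by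
      rw [map_sub]
      exact hOV hg')
    simpa using mem_returnTimes.1 hmem g rfl
  set W : Set H := closure (ι '' A) with hWdef
  have hAW : ∀ g, ι g ∈ W → g ∈ A := by
    intro g hg
    obtain ⟨O, hO, hgO, h⟩ := hopen g
    obtain ⟨_, hyO, g', hg', rfl⟩ := mem_closure_iff.1 hg O hO hgO
    exact (h g' hyO).1 hg'
  have hint : ∀ g ∈ A, ι g ∈ interior W := by
    intro g hg
    obtain ⟨O, hO, hgO, h⟩ := hopen g
    refine mem_interior.2 ⟨O, ?_, hO, hgO⟩
    refine (hι.open_subset_closure_inter hO).trans (closure_mono ?_)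
    rintro _ ⟨hyO, g', rfl⟩
    exact ⟨g', (h g' hyO).2 hg, rfl⟩
  have hW : IsCompact W := by
    refine isCompact_iff_totallyBounded_isComplete.2
      ⟨TotallyBounded.closure ?_, isClosed_closure.isComplete⟩
    refine totallyBounded_iff_subset_finite_iUnion_nhds_zero.2 fun V hV => ?_
    obtain ⟨_, ⟨K, hK, rfl⟩, hKV⟩ := hVS V hV
    obtain ⟨F, hF, hcov⟩ := hA.exists_finite_cover hM hK
    refine ⟨ι '' F, hF.image ι, ?_⟩
    rintro _ ⟨b, hb, rfl⟩
    obtain ⟨f, hf, hbf⟩ := hcov b hb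
    refine mem_iUnion₂.2 ⟨ι f, ⟨f, hf, rfl⟩, ι (b - f), hKV hbf, ?_⟩
    simp
  have hlc : LocallyCompactSpace H :=
    hW.locallyCompactSpace_of_mem_nhds_of_addGroup (mem_interior_iff_mem_nhds.1 (hint a ha))
  have hmem : ∀ γ : H × G, γ ∈ (ι.prod (AddMonoidHom.id G)).range ↔ γ.1 = ι γ.2 := by
    rintro ⟨h, g⟩
    simp only [AddMonoidHom.mem_range, AddMonoidHom.prod_apply, AddMonoidHom.id_apply,
      Prod.mk.injEq]
    exact ⟨fun ⟨_, h1, h2⟩ => by rw [← h1, h2], fun h1 => ⟨g, h1.symm, rfl⟩⟩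
  refine ⟨H, inferInstance, inferInstance, inferInstance, hlc, inferInstance,
    (ι.prod (AddMonoidHom.id G)).range, W, ⟨?_, ?_⟩, hW, ?_, ?_, ?_⟩
  -- An internally small difference moves `a` to a point of `A`, and uniform discreteness of `A`
  -- then makes it zero if it is also small in `G`.
  · obtain ⟨V, hV, hVA⟩ := hSV _ ⟨{a}, isCompact_singleton, rfl⟩
    obtain ⟨U, hU, hUA⟩ := hM.uniformlyDiscrete
    refine ⟨V ×ˢ U, prod_mem_nhds hV hU, fun x hx y hy hxy => ?_⟩
    rw [SetLike.mem_coe, hmem] at hx hy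
    have h1 : x.2 - y.2 ∈ returnTimes A {a} := hVA (show ι (x.2 - y.2) ∈ V by
      rw [map_sub, ← hx, ← hy]
      exact hxy.1)
    have h2 := (mem_returnTimes.1 h1 a rfl).2 ha
    have h3 := hUA _ h2 a ha (by simpa using hxy.2)
    have h4 : x.2 = y.2 := by simpa [sub_eq_zero] using h3
    exact Prod.ext (by rw [hx, hy, h4]) h4
  · obtain ⟨K, hK, hd⟩ := hM.relativelyDense
    refine ⟨(W - {ι a} - W) ×ˢ K,
      (isCompact_sub (isCompact_sub hW isCompact_singleton) hW).prod hK, fun ⟨h, g⟩ => ?_⟩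
    have hcont : Continuous fun y : H => h - y + ι a := by fun_prop
    -- Density of `ι` fixes the internal coordinate up to `W - ι a`; correcting the physical one by
    -- `b ∈ A` costs only `ι b ∈ W`.
    obtain ⟨_, hy, g', rfl⟩ := hι.inter_open_nonempty _ (isOpen_interior.preimage hcont)
      ⟨h, by simpa using hint a ha⟩
    obtain ⟨b, hb, k, hk, e⟩ := hd (g - g')
    refine ⟨(ι (g' + b), g' + b), (hmem _).2 rfl, (h - ι g' + ι a - ι a - ι b, k),
      ⟨⟨_, ⟨_, interior_subset hy, _, rfl, rfl⟩, _, subset_closure ⟨b, hb, rfl⟩, rfl⟩, hk⟩, ?_⟩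
    refine Prod.ext ?_ ?_
    · simp only [map_add, Prod.fst_add]; abel
    · simp only [Prod.snd_add]
      rw [add_assoc, ← e]; abel
  · refine Subset.antisymm (closure_mono ?_) (closure_minimal interior_subset isClosed_closure)
    rintro _ ⟨b, hb, rfl⟩
    exact hint b hb
  · intro γ hγ hfr
    rw [hmem] at hγ
    rw [hγ] at hfr
    exact hfr.2 (hint _ (hAW _ (isClosed_closure.frontier_subset hfr)))
  · ext g
    simp only [cutAndProject, mem_ofPred_eq, hmem, exists_eq_left]
    exact ⟨fun hg => subset_closure ⟨g, hg, rfl⟩, hAW g⟩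

end ReturnTimes

/-! ### A criterion for maximality of an equicontinuous factor. -/

section EquicontinuousFactors

variable {G : Type u} [AddCommGroup G] [TopologicalSpace G]

/-- A minimal equicontinuous factor with a one-point fibre is maximal. -/
theorem IsFactorMap.isMaxEquicontinuousFactor {X Y : Type v} [TopologicalSpace X] [CompactSpace X]
    [AddAction G X] [UniformSpace Y] [T2Space Y] [AddAction G Y] {π : X → Y}
    (hπ : IsFactorMap G π) (hY : IsEquicontinuousAction G Y)
    (hmin : ∀ y : Y, DenseRange fun t : G => t +ᵥ y) {x : X} (hx : ∀ x', π x' = π x → x' = x) :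
    IsMaxEquicontinuousFactor G π := by
  refine ⟨hπ, hY, fun Z _ _ _ _ _ ρ hρ hZ => ?_⟩
  have key : ∀ B B', π B = π B' → ρ B = ρ B' := by
    intro B B' hBB
    refine eq_of_uniformity fun {E} hE => ?_
    obtain ⟨D, hD, hDsymm, hDE⟩ := comp_symm_mem_uniformity_sets (hZ E hE)
    obtain ⟨M, hM, hMN⟩ := exists_nhds_preimage_subset hπ.continuous hx
      (hρ.continuous.continuousAt (UniformSpace.ball_mem_nhds (ρ x) hD))
    -- One `t` moves the common image of `B` and `B'` near `π x`, hence both points near `x`, where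
    -- `ρ` is almost constant. Equicontinuity carries this closeness back by `-t`.
    obtain ⟨_, ht, t, rfl⟩ := mem_closure_iff_nhds.1 (hmin (π B) (π x)) M hM
    have h1 : (ρ x, ρ (t +ᵥ B)) ∈ D := hMN (show π (t +ᵥ B) ∈ M by
      rw [hπ.map_vadd]
      exact ht)
    have h2 : (ρ x, ρ (t +ᵥ B')) ∈ D := hMN (show π (t +ᵥ B') ∈ M by
      rw [hπ.map_vadd, ← hBB]
      exact ht)
    have h3 : (-t +ᵥ ρ (t +ᵥ B), -t +ᵥ ρ (t +ᵥ B')) ∈ E :=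
      @hDE (ρ (t +ᵥ B), ρ (t +ᵥ B')) ⟨ρ x, SetRel.symm D h1, h2⟩ (-t)
    rwa [hρ.map_vadd, hρ.map_vadd, neg_vadd_vadd, neg_vadd_vadd] at h3
  have hφ : ∀ B, ρ (Function.surjInv hπ.surjective (π B)) = ρ B := fun B =>
    key _ _ (Function.surjInv_eq hπ.surjective _)
  have hcomp : ρ = (fun y => ρ (Function.surjInv hπ.surjective y)) ∘ π :=
    funext fun B => (hφ B).symm
  refine ⟨fun y => ρ (Function.surjInv hπ.surjective y), ⟨?_, ?_, ?_⟩, hcomp⟩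
  · have hq : IsQuotientMap π :=
      hπ.continuous.isClosedMap.isQuotientMap hπ.continuous hπ.surjective
    rw [hq.continuous_iff, ← hcomp]
    exact hρ.continuous
  · intro z
    obtain ⟨B, rfl⟩ := hρ.surjective z
    exact ⟨π B, hφ B⟩
  · intro t y
    obtain ⟨B, rfl⟩ := hπ.surjective y
    rw [← hπ.map_vadd, hφ, hφ, hρ.map_vadd]

end EquicontinuousFactors

/-! ### From rigidity to almost automorphy. -/

section AlmostAutomorphic

variable {G : Type u} [AddCommGroup G] [TopologicalSpace G] [IsTopologicalAddGroup G]
  [LocallyCompactSpace G] [T2Space G]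

/-- Adding neighbourhoods `U` of `0` to the return times makes `ι` continuous on `G`. Rigidity makes
`t +ᵥ x ↦ ι t` uniformly continuous on a dense orbit, and its extension `π` is onto a compact group
on which `G` acts by translations. -/
theorem IsPatchRigid.isAlmostAutomorphicPoint {Λ : Set G} (hΛ : IsMeyer Λ) {x : Hull Λ}
    (hA : IsPatchRigid x.carrier) (hx : ∀ B : Hull Λ, InHull x.carrier B.carrier) :
    IsAlmostAutomorphicPoint G x := by
  have hcX := Hull.compactSpace hΛ
  set A := x.carrier with hAdef
  obtain ⟨Y, _, _, _, _, _, ι, hι, hSV, hVS⟩ := exists_completion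
    {S | ∃ K U : Set G, IsCompact K ∧ U ∈ 𝓝 (0 : G) ∧ S = returnTimes A K + U}
    ⟨_, ∅, univ, isCompact_empty, univ_mem, rfl⟩
    (by
      rintro _ ⟨K, U, hK, hU, rfl⟩ _ ⟨L, V, hL, hV, rfl⟩
      exact ⟨_, ⟨K ∪ L, U ∩ V, hK.union hL, inter_mem hU hV, rfl⟩, subset_inter
        (add_subset_add (returnTimes_anti A subset_union_left) inter_subset_left)
        (add_subset_add (returnTimes_anti A subset_union_right) inter_subset_right)⟩)
    (by
      rintro _ ⟨K, U, -, hU, rfl⟩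
      exact ⟨0, zero_mem_returnTimes A K, 0, mem_of_mem_nhds hU, add_zero 0⟩)
    (by
      rintro _ ⟨K, U, hK, hU, rfl⟩
      obtain ⟨K', hK', h⟩ := hA.exists_sub_subset hK
      obtain ⟨U', hU', hUU⟩ := exists_nhds_half_neg hU
      refine ⟨_, ⟨K', U', hK', hU', rfl⟩, ?_⟩
      rw [add_sub_add_comm]
      refine add_subset_add h ?_
      rintro _ ⟨a, ha, b, hb, rfl⟩
      exact hUU a ha b hb)
  have hunif : ∀ E ∈ uniformity Y, ∃ V ∈ 𝓝 (0 : Y), ∀ y z, z - y ∈ V → (y, z) ∈ E := by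
    intro E hE
    rw [uniformity_eq_comap_nhds_zero] at hE
    obtain ⟨V, hV, h⟩ := hE
    exact ⟨V, hV, fun y z hyz => h hyz⟩
  have hιc : Continuous ι := by
    refine continuous_of_continuousAt_zero ι fun V hV => ?_
    rw [map_zero] at hV
    obtain ⟨_, ⟨K, U, hK, hU, rfl⟩, h⟩ := hVS V hV
    exact mem_map.2 (mem_of_superset hU fun u hu =>
      h ⟨0, zero_mem_returnTimes A K, u, hu, zero_add u⟩)
  have key : ∀ V ∈ 𝓝 (0 : Y), ∃ K U : Set G, IsCompact K ∧ U ∈ 𝓝 (0 : G) ∧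
      ∀ s t : G, (s +ᵥ x, t +ᵥ x) ∈ hullEntourage Λ K U → ι t - ι s ∈ V := by
    intro V hV
    obtain ⟨_, ⟨K, U, hK, hU, rfl⟩, h⟩ := hVS V hV
    obtain ⟨K', hK', hr⟩ := hA K hK
    obtain ⟨U', hU', hUU⟩ := exists_nhds_half_neg hU
    refine ⟨K', U', hK', hU', fun s t hst => ?_⟩
    obtain ⟨u, hu, u', hu', h1⟩ := mem_hullEntourage.1 hst
    simp only [Hull.carrier_vadd, mem_translateSet, ← hAdef, add_assoc] at h1
    rw [← map_sub]
    refine h ⟨_, mem_returnTimes.2 (hr (u + s) (u' + t) h1), u - u', hUU u hu u' hu', ?_⟩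
    simp only; abel
  let e : G → Hull Λ := fun t => t +ᵥ x
  have hd : Dense (range e) := Hull.denseRange_vadd x hx
  -- The choice of `t` is harmless: by `key`, two `t` giving the same point of the orbit have the
  -- same image under `ι`.
  let f : range e → Y := fun b => ι b.2.choose
  have hf : UniformContinuous f := by
    intro E hE
    obtain ⟨V, hV, hVE⟩ := hunif E hE
    obtain ⟨K, U, hK, hU, h⟩ := key V hV
    refine mem_map.2 (mem_comap.2 ⟨_, hullEntourage_mem_uniformity Λ hK hU, ?_⟩)
    rintro ⟨b, b'⟩ hbb
    refine hVE _ _ (h _ _ ?_)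
    have h1 : b.2.choose +ᵥ x = b := b.2.choose_spec
    have h2 : b'.2.choose +ᵥ x = b' := b'.2.choose_spec
    rw [h1, h2]
    exact hbb
  obtain ⟨π, hπdef⟩ : ∃ π, π = hd.extend f := ⟨_, rfl⟩
  have hπu : UniformContinuous π := hπdef ▸ Dense.uniformContinuous_extend hd hf
  have hπe : ∀ t, π (t +ᵥ x) = ι t := by
    intro t
    have h1 := Dense.extend_of_ind hd hf ⟨e t, t, rfl⟩
    rw [hπdef]
    refine h1.trans (eq_of_uniformity fun {E} hE => ?_)
    obtain ⟨V, hV, hVE⟩ := hunif E hE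
    obtain ⟨K, U, hK, hU, h⟩ := key V hV
    refine hVE _ _ (h _ _ ?_)
    have h2 : (⟨t, rfl⟩ : e t ∈ range e).choose +ᵥ x = t +ᵥ x :=
      (⟨t, rfl⟩ : e t ∈ range e).choose_spec
    rw [h2]
    exact mem_hullEntourage.2 ⟨0, mem_of_mem_nhds hU, 0, mem_of_mem_nhds hU, fun _ _ => Iff.rfl⟩
  have hπs : Function.Surjective π := by
    have hsub : range ι ⊆ range π := by
      rintro _ ⟨t, rfl⟩
      exact ⟨_, hπe t⟩
    have : IsClosed (range π) := (isCompact_range hπu.continuous).isClosed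
    exact range_eq_univ.1 (univ_subset_iff.1 (hι.closure_eq ▸ closure_minimal hsub this))
  have hcY : CompactSpace Y := ⟨by
    rw [← hπs.range_eq]
    exact isCompact_range hπu.continuous⟩
  let : AddAction G Y := AddAction.compHom Y ι
  have hcont : ContinuousVAdd G Y :=
    ⟨((hιc.comp continuous_fst).add continuous_snd : Continuous fun p : G × Y => ι p.1 + p.2)⟩
  have hfac : IsFactorMap G π := by
    refine ⟨hπu.continuous, hπs, fun t B => ?_⟩
    refine congrFun (Continuous.ext_on hd (hπu.continuous.comp (Hull.continuous_vadd t))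
      (hπu.continuous.const_add (ι t)) ?_) B
    rintro _ ⟨s, rfl⟩
    change π (t +ᵥ (s +ᵥ x)) = ι t + π (s +ᵥ x)
    rw [vadd_vadd, hπe, hπe, map_add]
  have hequi : IsEquicontinuousAction G Y := by
    intro E hE
    obtain ⟨V, hV, hVE⟩ := hunif E hE
    rw [uniformity_eq_comap_nhds_zero]
    refine mem_comap.2 ⟨V, hV, fun p hp t => hVE _ _ ?_⟩
    change (ι t + p.2) - (ι t + p.1) ∈ V
    rw [add_sub_add_left_eq_sub]
    exact hp
  have hfib : ∀ B, π B = π x → B = x := by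
    intro B hB
    have hπx : π x = 0 := by simpa using hπe 0
    rw [hπx] at hB
    have happ : ∀ K U : Set G, IsCompact K → U ∈ 𝓝 (0 : G) →
        ∃ u ∈ U, ∀ y ∈ K, y ∈ B.carrier ↔ y + u ∈ A := by
      intro K U hK hU
      obtain ⟨C, hC, hC0⟩ := exists_compact_mem_nhds (0 : G)
      obtain ⟨V, hV, hVS'⟩ := hSV _ ⟨K + C, U ∩ C, hK.add hC, inter_mem hU hC0, rfl⟩
      have hE : {p : Y × Y | p.2 - p.1 ∈ V} ∈ uniformity Y := by
        rw [uniformity_eq_comap_nhds_zero]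
        exact preimage_mem_comap hV
      obtain ⟨L, U', hL, hU', hLU⟩ := mem_uniformity_hull.1 (hπu hE)
      -- `B` looks like `A - t` with `ι t` near `π B = 0`, so `t` is a return time plus a small `u`.
      -- The return time can be dropped, and letting `u` tend to `0` gives `B = x` because both sets
      -- are closed.
      obtain ⟨t, ht⟩ := inHull_iff.1 (hx B) (K ∪ L) (hK.union hL)
      have h1 : (B, t +ᵥ x) ∈ hullEntourage Λ L U' :=
        mem_hullEntourage.2 ⟨0, mem_of_mem_nhds hU', 0, mem_of_mem_nhds hU', fun y hy => by
          simpa [Hull.carrier_vadd, mem_translateSet] using ht y (Or.inr hy)⟩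
      have h2 : π (t +ᵥ x) - π B ∈ V := hLU h1
      rw [hπe, hB, sub_zero] at h2
      obtain ⟨r, hr, u, hu, rfl⟩ := hVS' h2
      refine ⟨u, hu.1, fun y hy => (ht y (Or.inl hy)).trans ?_⟩
      rw [← mem_returnTimes.1 hr (y + u) ⟨y, hy, u, hu.2, rfl⟩,
        show y + (r + u) = y + u + r by abel]
    have hcl : ∀ B : Hull Λ, IsClosed B.carrier := fun B =>
      (B.inHull.isMeyer hΛ).uniformlyDiscrete.isLocallyFiniteSet.isClosed
    refine Hull.ext (Subset.antisymm (fun b hb => ?_) fun a ha => ?_)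
    · by_contra hbA
      have h1 : Tendsto (fun u : G => b + u) (𝓝 0) (𝓝 b) := by
        simpa using (continuous_const_add b).tendsto 0
      obtain ⟨u, hu, h⟩ := happ {b} _ isCompact_singleton
        (h1 ((hcl x).isOpen_compl.mem_nhds hbA))
      exact hu ((h b rfl).1 hb)
    · by_contra haB
      obtain ⟨C, hC, hC0⟩ := exists_compact_mem_nhds (0 : G)
      have h1 : Tendsto (fun u : G => a - u) (𝓝 0) (𝓝 a) := by
        simpa using (continuous_sub_left a).tendsto 0
      obtain ⟨u, hu, h⟩ := happ ({a} - C) _ (isCompact_sub isCompact_singleton hC)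
        (inter_mem (h1 ((hcl B).isOpen_compl.mem_nhds haB)) hC0)
      exact hu.1 ((h (a - u) ⟨a, rfl, u, hu.2, rfl⟩).2 (by simpa using ha))
  refine ⟨Y, inferInstance, hcY, inferInstance, inferInstance, hcont, π,
    hfac.isMaxEquicontinuousFactor hequi (fun y => ?_) hfib, hfib⟩
  exact (Homeomorph.addRight y).surjective.denseRange.comp hι (Homeomorph.addRight y).continuous

theorem isAlmostAutomorphicPoint_of_isNonsingularModelSet {Λ : Set G} (hΛ : IsMeyer Λ)
    {x : Hull Λ} (hA : IsNonsingularModelSet x.carrier)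
    (hx : ∀ B : Hull Λ, InHull x.carrier B.carrier) : IsAlmostAutomorphicPoint G x :=
  (hA.isPatchRigid (x.inHull.isMeyer hΛ)).isAlmostAutomorphicPoint hΛ hx

theorem isNonsingularModelSet_of_fiber_eq_singleton {Λ : Set G} (hΛ : IsMeyer Λ) {Y : Type v}
    [UniformSpace Y] [T2Space Y] [AddAction G Y] {π : Hull Λ → Y} (hπ : IsFactorMap G π)
    (hY : IsEquicontinuousAction G Y) {x : Hull Λ} (hx : ∀ x', π x' = π x → x' = x) :
    IsNonsingularModelSet x.carrier :=
  (isPatchRigid_of_fiber_eq_singleton hΛ hπ hY hx).isNonsingularModelSet (x.inHull.isMeyer hΛ)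

end AlmostAutomorphic

end MeyerSets

theorem mainTheorem1 {G : Type u} [AddCommGroup G] [TopologicalSpace G] [IsTopologicalAddGroup G]
    [LocallyCompactSpace G] [T2Space G] [SecondCountableTopology G] [SigmaCompactSpace G]
    (Λ : Set G) :
    (MeyerSets.IsRepetitiveModelSet Λ ↔
      MeyerSets.IsMeyer Λ ∧ MeyerSets.IsRepetitive Λ ∧
        MeyerSets.IsAlmostAutomorphic G (MeyerSets.Hull Λ)) ∧
    (MeyerSets.IsMeyer Λ →
      (MeyerSets.IsNonsingularModelSet Λ ↔
        MeyerSets.IsAlmostAutomorphicPoint G (MeyerSets.Hull.base Λ))) := by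
  refine ⟨⟨?_, ?_⟩, fun hΛ => ⟨fun h => ?_, ?_⟩⟩
  · rintro ⟨Λ₀, hM, hR, hΛ, Λ', hΛ', hns⟩
    have hMΛ := hΛ.isMeyer hM
    have hRΛ := hΛ.isRepetitive hR
    refine ⟨hMΛ, hRΛ, ?_⟩
    -- By minimality, `Λ'` lies in the hull of `Λ` and has a dense orbit there.
    obtain ⟨Y, i₁, i₂, i₃, i₄, i₅, π, hπ, hfib⟩ :=
      MeyerSets.isAlmostAutomorphicPoint_of_isNonsingularModelSet hMΛ
        (x := ⟨Λ', hΛ.inHull_of_isRepetitive hR hΛ'⟩) hns fun B =>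
          (hΛ.inHull_of_isRepetitive hR hΛ').inHull_of_isRepetitive hRΛ B.inHull
    exact ⟨Y, i₁, i₂, i₃, i₄, i₅, π, hπ, _, _, rfl, hfib⟩
  · rintro ⟨hM, hR, Y, _, _, _, _, _, π, hπ, _, x, rfl, hfib⟩
    exact ⟨Λ, hM, hR, MeyerSets.InHull.refl Λ, x.carrier, x.inHull,
      MeyerSets.isNonsingularModelSet_of_fiber_eq_singleton hM hπ.isFactorMap hπ.equicontinuous
        hfib⟩
  -- The orbit of `Λ` is dense in its own hull by definition, so repetitivity is not needed.
  · exact MeyerSets.isAlmostAutomorphicPoint_of_isNonsingularModelSet hΛ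
      (x := MeyerSets.Hull.base Λ) h fun B => B.inHull
  · rintro ⟨Y, _, _, _, _, _, π, hπ, hfib⟩
    exact MeyerSets.isNonsingularModelSet_of_fiber_eq_singleton hΛ hπ.isFactorMap
      hπ.equicontinuous (x := MeyerSets.Hull.base Λ) hfib
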